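/- Throughout, representations are on finite-dimensional real vector spaces. For a finite-dimensional Euclidean space $V$ let $C(V)$ be the Clifford algebra with $v^2=-|v|^2$ for $v\in V$, let $\alpha$ be the algebra automorphism of $C(V)$ with $\alpha(v)=-v$ on $V$, and let $t$ be the anti-automorphism of $C(V)$ fixing $V$ pointwise. Put $\Gamma_V=\{x\in C(V)^\times : \alpha(x)Vx^{-1}=V\}$, let $\rho:\Gamma_V\to \mathrm{GL}(V)$ be given by $\rho(x)(v)=\alpha(x)vx^{-1}$, and let $\mathrm{Pin}(V)=\{x\in\Gamma_V : x\,t(\alpha(x))=1\}$, so that $\rho:\mathrm{Pin}(V)\to \mathrm{O}(V)$ is a double cover. A representation $\pi:G\to \mathrm{O}(V)$ of a finite group $G$ is called spinorial if there is a group homomorphism $\hat\pi:G\to\mathrm{Pin}(V)$ with $\rho\circ\hat\pi=\pi$. **Theorem.** Let $n,n'\ge 2$, let $(\pi,V)$ and $(\pi',V')$ be real representations of the symmetric groups $S_n$ and $S_{n'}$, and let $\Pi=\pi\boxtimes\pi'$ be their external tensor product, a representation of $S_n\times S_{n'}$ on $V\otimes V'$. Give $V\otimes V'$ any inner product preserved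 by $\Pi$. Then $\Pi$ is spinorial if and only if the restrictions of $\Pi$ to $S_n\times\{1\}$ and to $\{1\}\times S_{n'}$ are both spinorial and $$(\deg\Pi+1)\,g\,g'\equiv 0 \pmod 2,$$ where $\deg\Pi=\dim (V\otimes V')$, and $g$ and $g'$ are the multiplicities of $-1$ as an eigenvalue of $\pi(s_1)$ and of $\pi'(s_1)$, with $s_1$ the transposition $(1\,2)$ of $S_n$ and of $S_{n'}$ respectively. -/

import Mathlib

open scoped TensorProduct

noncomputable section

namespace PinLift

open CliffordAlgebra

variable {V : Type*} [AddCommGroup V] [Module ℝ V]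

/-- The Clifford algebra `C(V)` of a real vector space with squared norm `Q`, with the sign
convention `v * v = - Q v`. -/
abbrev Cl (Q : QuadraticForm ℝ V) : Type _ := CliffordAlgebra (-Q)

theorem ι_injective (Q : QuadraticForm ℝ V) : Function.Injective (ι (-Q)) := by
  intro v w h
  have := congrArg (CliffordAlgebra.equivExterior (-Q)) h
  simpa using this

/-- For a unit `x` of `C(V)`, the linear map `y ↦ α(x) y x⁻¹` of `C(V)`, where `α` is the
involution of `C(V)` with `α(v) = -v` for `v ∈ V`. -/
def twistedConj (Q : QuadraticForm ℝ V) : (Cl Q)ˣ →* Module.End ℝ (Cl Q) where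
  toFun x := LinearMap.mulLeft ℝ (involute (x : Cl Q)) ∘ₗ
    LinearMap.mulRight ℝ ((x⁻¹ : (Cl Q)ˣ) : Cl Q)
  map_one' := by ext; simp
  map_mul' x y := by
    refine LinearMap.ext fun z => ?_
    simp [mul_assoc]

theorem twistedConj_apply (Q : QuadraticForm ℝ V) (x : (Cl Q)ˣ) (y : Cl Q) :
    twistedConj Q x y = involute (x : Cl Q) * y * ((x⁻¹ : (Cl Q)ˣ) : Cl Q) := by
  simp [twistedConj, mul_assoc]

/-- The Clifford group `Γ_V`: the units `x` of `C(V)` with `α(x) V x⁻¹ = V`. -/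
def cliffordGroup (Q : QuadraticForm ℝ V) : Subgroup (Cl Q)ˣ where
  carrier := {x | (LinearMap.range (ι (-Q))).map (twistedConj Q x) = LinearMap.range (ι (-Q))}
  one_mem' := by
    rw [Set.mem_ofPred_eq, map_one]
    exact Submodule.map_id _
  mul_mem' {x y} hx hy := by
    rw [Set.mem_ofPred_eq] at *
    rw [map_mul, Module.End.mul_eq_comp, Submodule.map_comp, hy, hx]
  inv_mem' {x} hx := by
    rw [Set.mem_ofPred_eq] at *
    conv_lhs => rw [← hx]
    rw [← Submodule.map_comp, ← Module.End.mul_eq_comp, ← map_mul, inv_mul_cancel, map_one]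
    exact Submodule.map_id _

theorem twistedConj_ι_mem (Q : QuadraticForm ℝ V) (x : cliffordGroup Q) :
    ∀ y ∈ LinearMap.range (ι (-Q)), twistedConj Q (x : (Cl Q)ˣ) y ∈ LinearMap.range (ι (-Q)) := by
  intro y hy
  have h : (LinearMap.range (ι (-Q))).map (twistedConj Q (x : (Cl Q)ˣ)) =
    LinearMap.range (ι (-Q)) := x.2
  rw [← h]
  exact Submodule.mem_map_of_mem hy

/-- The endomorphism `v ↦ α(x) v x⁻¹` of `V` given by an element `x` of `Γ_V`. -/
def rhoMap (Q : QuadraticForm ℝ V) (x : cliffordGroup Q) : Module.End ℝ V :=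
  ((LinearEquiv.ofInjective (ι (-Q)) (ι_injective Q)).symm : _ →ₗ[ℝ] V) ∘ₗ
    (twistedConj Q (x : (Cl Q)ˣ)).restrict (twistedConj_ι_mem Q x) ∘ₗ
    ((LinearEquiv.ofInjective (ι (-Q)) (ι_injective Q)) : V →ₗ[ℝ] _)

theorem ι_rhoMap (Q : QuadraticForm ℝ V) (x : cliffordGroup Q) (v : V) :
    ι (-Q) (rhoMap Q x v) = twistedConj Q (x : (Cl Q)ˣ) (ι (-Q) v) := by
  have h := LinearEquiv.apply_symm_apply (LinearEquiv.ofInjective (ι (-Q)) (ι_injective Q))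
    ((twistedConj Q (x : (Cl Q)ˣ)).restrict (twistedConj_ι_mem Q x)
      (LinearEquiv.ofInjective (ι (-Q)) (ι_injective Q) v))
  exact congrArg Subtype.val h

/-- The homomorphism `ρ : Γ_V → GL(V)`, `ρ(x)(v) = α(x) v x⁻¹`, written with values in the
endomorphisms of `V` (it then takes values in the invertible ones). -/
def rho (Q : QuadraticForm ℝ V) : cliffordGroup Q →* Module.End ℝ V where
  toFun := rhoMap Q
  map_one' := by
    refine LinearMap.ext fun v => ι_injective Q ?_
    rw [ι_rhoMap]
    simp
  map_mul' x y := by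
    refine LinearMap.ext fun v => ι_injective Q ?_
    rw [ι_rhoMap, Module.End.mul_apply, ι_rhoMap, ι_rhoMap, Subgroup.coe_mul, map_mul,
      Module.End.mul_apply]

theorem ι_rho (Q : QuadraticForm ℝ V) (x : cliffordGroup Q) (v : V) :
    ι (-Q) (rho Q x v) = involute ((x : (Cl Q)ˣ) : Cl Q) * ι (-Q) v *
      (((x : (Cl Q)ˣ)⁻¹ : (Cl Q)ˣ) : Cl Q) :=
  (ι_rhoMap Q x v).trans (twistedConj_apply Q _ _)

/-- The group `Pin(V)`: the elements `x` of `Γ_V` with `N(x) = x * t(α(x)) = 1`, where `t` is the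
anti-involution of `C(V)` (`reverse`) that fixes `V`. -/
def Pin (Q : QuadraticForm ℝ V) : Subgroup (cliffordGroup Q) where
  carrier := {x | ((x : (Cl Q)ˣ) : Cl Q) * reverse (involute ((x : (Cl Q)ˣ) : Cl Q)) = 1}
  one_mem' := by simp
  mul_mem' {x y} hx hy := by
    rw [Set.mem_ofPred_eq] at *
    rw [Subgroup.coe_mul, Units.val_mul, map_mul, reverse.map_mul]
    calc _ = ((x : (Cl Q)ˣ) : Cl Q) *
          (((y : (Cl Q)ˣ) : Cl Q) * reverse (involute ((y : (Cl Q)ˣ) : Cl Q))) *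
          reverse (involute ((x : (Cl Q)ˣ) : Cl Q)) := by simp only [mul_assoc]
      _ = 1 := by rw [hy, mul_one, hx]
  inv_mem' {x} hx := by
    rw [Set.mem_ofPred_eq] at *
    have h : ((x : (Cl Q)ˣ)⁻¹ : (Cl Q)ˣ) = reverse (involute ((x : (Cl Q)ˣ) : Cl Q)) :=
      Units.inv_eq_of_mul_eq_one_right hx
    have h2 := star_star ((x : (Cl Q)ˣ) : Cl Q)
    rw [star_def, star_def] at h2
    rw [Subgroup.coe_inv]
    nth_rewrite 2 [h]
    rw [h2, Units.inv_mul]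

/-- A representation `π` of `G` on a real vector space with squared norm `Q` is spinorial if it
lifts to `Pin(V)`: there is a homomorphism `G → Pin(V)` whose composition with `ρ` is `π`. -/
def IsSpinorial {G : Type*} [Group G] (Q : QuadraticForm ℝ V) (π : Representation ℝ G V) : Prop :=
  ∃ f : G →* Pin Q, ∀ g : G, rho Q (f g : cliffordGroup Q) = π g

/-- The representation `π` preserves the squared norm `Q`, i.e. has its image in `O(V)`. -/
def IsOrthogonal {G : Type*} [Group G] (Q : QuadraticForm ℝ V) (π : Representation ℝ G V) : Prop :=
  ∀ (g : G) (v : V), Q (π g v) = Q v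

/-- The external tensor product `π ⊠ π'` of representations of `G` and `G'`, a representation of
`G × G'` on `V ⊗ V'`. -/
def extTensor {G G' : Type*} [Group G] [Group G'] {V' : Type*} [AddCommGroup V'] [Module ℝ V']
    (π : Representation ℝ G V) (π' : Representation ℝ G' V') :
    Representation ℝ (G × G') (V ⊗[ℝ] V') :=
  Representation.tprod (π.comp (MonoidHom.fst G G')) (π'.comp (MonoidHom.snd G G'))

/-- The restriction of a representation to a subgroup. -/
def restrictTo {G : Type*} [Group G] (π : Representation ℝ G V) (H : Subgroup G) :
    Representation ℝ H V :=
  π.comp H.subtype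

/-- The transposition `s₁` of the first two of the `n` letters. -/
def s₁ (n : ℕ) (hn : 2 ≤ n) : Equiv.Perm (Fin n) :=
  Equiv.swap ⟨0, by omega⟩ ⟨1, by omega⟩

/-- The multiplicity of `-1` as an eigenvalue of `π(s₁)`. -/
def gMult (n : ℕ) (hn : 2 ≤ n) (π : Representation ℝ (Equiv.Perm (Fin n)) V) : ℕ :=
  Module.finrank ℝ (Module.End.eigenspace (π (s₁ n hn)) (-1))

end PinLift

end

/-! ### Elements of the Clifford algebra that twisted-commute with all vectors -/

section Kernel

open CliffordAlgebra

/-! A lift of `Π` restricts to both factors. Conversely, lifts on the two factors combine to a lift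
of `Π` as soon as their images commute, and for this it is enough to look at transpositions `σ`,
`τ`, which generate.

There the question is a sign in the Clifford algebra. The commuting orthogonal involutions `π σ ⊗ 1`
and `1 ⊗ π' τ` are diagonal in a common orthogonal basis, with `-1` on the index sets `I` and `J`.
Any lift is a scalar times the product of the basis vectors over `I` (resp. `J`), because an element
that twisted-commutes with all vectors is a scalar. Reordering the two products costs `(-1) ^ (|I|
|J| + |I ∩ J|)`, whichever lifts are chosen. Traces give `|I| = g dim V'`, `|J| = g' dim V` and `|I
∩ J| = g g'`, so the exponent is `(deg Π + 1) g g'`: lifts of `σ` and `τ` commute exactly when it is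
even. -/

theorem ExteriorAlgebra.mem_range_algebraMap_of_contractLeft_coord_eq_zero
    {K M ι' : Type*} [Field K] [CharZero K] [AddCommGroup M] [Module K M] [Fintype ι']
    (b : Module.Basis ι' K M) (z : ExteriorAlgebra K M)
    (hz : ∀ i, contractLeft (b.coord i) z = 0) :
    z ∈ (algebraMap K (ExteriorAlgebra K M)).range := by
  classical
  -- The number operator: it acts on `⋀[K]^k M` as multiplication by `k`. Since it kills `z`, in
  -- characteristic zero all components of `z` of positive degree vanish.
  let N : ExteriorAlgebra K M →ₗ[K] ExteriorAlgebra K M :=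
    ∑ i, LinearMap.mulLeft K (ExteriorAlgebra.ι K (b i)) ∘ₗ contractLeft (b.coord i)
  have hN : ∀ x, N x = ∑ i, ExteriorAlgebra.ι K (b i) * contractLeft (b.coord i) x := by
    intro x; simp [N]
  have hmul : ∀ (a : M) (x : ExteriorAlgebra K M),
      N (ExteriorAlgebra.ι K a * x) =
        ExteriorAlgebra.ι K a * x + ExteriorAlgebra.ι K a * N x := by
    intro a x
    have h1 : ∀ i, ExteriorAlgebra.ι K (b i) *
        contractLeft (b.coord i) (ExteriorAlgebra.ι K a * x) =
        ExteriorAlgebra.ι K (b.coord i a • b i) * x +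
          ExteriorAlgebra.ι K a * (ExteriorAlgebra.ι K (b i) * contractLeft (b.coord i) x) := by
      intro i
      have h2 := ExteriorAlgebra.ι_add_mul_swap (R := K) (b i) a
      rw [add_eq_zero_iff_eq_neg] at h2
      rw [ExteriorAlgebra.ι, contractLeft_ι_mul, mul_sub, ← mul_assoc, ← ExteriorAlgebra.ι, h2,
        map_smul]
      simp [mul_assoc]
    rw [hN, Finset.sum_congr rfl fun i _ => h1 i, Finset.sum_add_distrib, hN, Finset.mul_sum,
      ← Finset.sum_mul, ← map_sum]
    congr 3
    exact b.sum_repr a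
  have hdeg : ∀ (k : ℕ) (x : ExteriorAlgebra K M), x ∈ ⋀[K]^k M → N x = (k : K) • x := by
    intro k x hx
    induction hx using Submodule.pow_induction_on_left' with
    | algebraMap r => simp [hN]
    | add x y i hx hy ihx ihy => rw [map_add, ihx, ihy, smul_add]
    | mem_mul m hm i x hx ih =>
      obtain ⟨a, rfl⟩ := hm
      rw [hmul, ih, mul_smul_comm, Nat.cast_succ, add_smul, one_smul, add_comm]
  let A := fun i : ℕ ↦ ⋀[K]^i M
  have h0 : N z = 0 := by simp [hN, hz]
  have hsum : ∑ i ∈ (DirectSum.decompose A z).support, (DirectSum.decompose A z i : _) = z :=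
    DirectSum.sum_support_decompose A z
  have hcomp : ∀ k, k ≠ 0 → (DirectSum.decompose A z k : ExteriorAlgebra K M) = 0 := by
    intro k hk
    have h1 : N z = ∑ i ∈ (DirectSum.decompose A z).support,
        (i : K) • (DirectSum.decompose A z i : ExteriorAlgebra K M) := by
      conv_lhs => rw [← hsum]
      rw [map_sum]
      exact Finset.sum_congr rfl fun i _ => hdeg i _ (DirectSum.decompose A z i).2
    have h2 := congrArg (fun y => (DirectSum.decompose A y k : ExteriorAlgebra K M)) (h1.symm.trans h0)
    simp only [DirectSum.decompose_sum, DirectSum.decompose_smul, DirectSum.decompose_zero,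
      DirectSum.decompose_coe] at h2
    have h3 : (k : K) • (DirectSum.decompose A z k : ExteriorAlgebra K M) = 0 := by
      refine Eq.trans ?_ h2
      simp only [DirectSum.sum_apply, DirectSum.smul_apply, AddSubmonoidClass.coe_finsetSum,
        Submodule.coe_smul]
      rw [Finset.sum_eq_single k]
      · simp
      · intro i _ hik
        rw [DirectSum.of_eq_of_ne _ _ _ hik.symm]
        simp
      · intro hk'
        simp only [DFinsupp.mem_support_iff, not_not] at hk'
        rw [hk']
        simp
    exact (smul_eq_zero.mp h3).resolve_left (Nat.cast_ne_zero.mpr hk)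
  have hz0 : z ∈ A 0 := by
    rw [← hsum]
    refine Submodule.sum_mem _ fun i _ => ?_
    by_cases hi : i = 0
    · subst hi; exact (DirectSum.decompose A z 0).2
    · rw [hcomp i hi]; exact Submodule.zero_mem _
  have : z ∈ (1 : Submodule K (ExteriorAlgebra K M)) := by simpa [A] using hz0
  obtain ⟨r, hr⟩ := Submodule.mem_one.mp this
  exact ⟨r, hr⟩

namespace CliffordAlgebra

/-- The linear isomorphism `equivExterior` intertwines contractions and fixes scalars, which reduces
this to the exterior algebra. -/
theorem mem_range_algebraMap_of_contractLeft_coord_eq_zero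
    {K M ι' : Type*} [Field K] [CharZero K] [AddCommGroup M] [Module K M] [Fintype ι']
    {q : QuadraticForm K M} (b : Module.Basis ι' K M) (z : CliffordAlgebra q)
    (hz : ∀ i, contractLeft (b.coord i) z = 0) :
    z ∈ (algebraMap K (CliffordAlgebra q)).range := by
  have : Invertible (2 : K) := invertibleOfNonzero two_ne_zero
  obtain ⟨r, hr⟩ := ExteriorAlgebra.mem_range_algebraMap_of_contractLeft_coord_eq_zero b
    (equivExterior q z) fun i => by
      change contractLeft (b.coord i) (changeForm changeForm.associated_neg_proof z) = 0
      rw [← changeForm_contractLeft, hz, map_zero]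
  refine ⟨r, (equivExterior q).injective ?_⟩
  rw [← hr]
  exact changeForm_algebraMap changeForm.associated_neg_proof r

/-- Both sides obey the same twisted Leibniz rule under left multiplication by a vector. Thus
twisted-commuting with `v` means being killed by a contraction. -/
theorem ι_mul_sub_involute_mul_ι {R M : Type*} [CommRing R] [AddCommGroup M] [Module R M]
    {q : QuadraticForm R M} (v : M) (x : CliffordAlgebra q) :
    ι q v * x - involute x * ι q v = contractLeft (q.polarBilin v) x := by
  induction x using CliffordAlgebra.left_induction with
  | algebraMap r => simp [Algebra.commutes r (ι q v)]
  | add x y hx hy => rw [map_add, map_add, ← hx, ← hy]; noncomm_ring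
  | ι_mul x m hx =>
    rw [contractLeft_ι_mul, ← hx, map_mul, involute_ι, Algebra.smul_def]
    have h := ι_mul_ι_add_swap (Q := q) v m
    have h' : algebraMap R (CliffordAlgebra q) (q.polarBilin v m) = ι q v * ι q m + ι q m * ι q v :=
      h.symm
    rw [h']
    noncomm_ring

/-- An element that twisted-commutes with all vectors of a form with an orthogonal basis of
anisotropic vectors is a scalar. -/
theorem mem_range_algebraMap_of_involute_mul_ι_eq
    {K M ι' : Type*} [Field K] [CharZero K] [AddCommGroup M] [Module K M] [Fintype ι']
    {q : QuadraticForm K M} (b : Module.Basis ι' K M)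
    (hb : Pairwise fun i j => q.polarBilin (b i) (b j) = 0) (hb' : ∀ i, q (b i) ≠ 0)
    (z : CliffordAlgebra q) (hz : ∀ v, involute z * ι q v = ι q v * z) :
    z ∈ (algebraMap K (CliffordAlgebra q)).range := by
  refine mem_range_algebraMap_of_contractLeft_coord_eq_zero b z fun i => ?_
  have h1 : q.polarBilin (b i) = (2 * q (b i)) • b.coord i := by
    refine b.ext fun j => ?_
    rcases eq_or_ne i j with rfl | hij
    · simp [two_mul]
    · rw [hb hij]; simp [hij.symm]
  have h2 := ι_mul_sub_involute_mul_ι (b i) z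
  rw [hz, sub_self, h1, map_smul, LinearMap.smul_apply] at h2
  exact (smul_eq_zero.mp h2.symm).resolve_left (mul_ne_zero two_ne_zero (hb' i))

end CliffordAlgebra

end Kernel

/-! ### Lifts of diagonal involutions as products of orthogonal vectors -/

section Lifts

namespace CliffordAlgebra

variable {K M ι' : Type*} [Field K] [AddCommGroup M] [Module K M]
  {q : QuadraticForm K M} {b : ι' → M}

/-- Each factor orthogonal to `b j` anticommutes with it, and `involute` cancels that sign; only the
factors equal to `b j` leave a `-1`. Hence such a product lifts a composite of reflections. -/
theorem involute_prod_map_ι_mul_ι [DecidableEq ι']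
    (hb : Pairwise fun i j => q.polarBilin (b i) (b j) = 0)
    (l : List ι') (j : ι') :
    involute (l.map fun i => ι q (b i)).prod * ι q (b j) =
      (-1 : K) ^ l.count j • (ι q (b j) * (l.map fun i => ι q (b i)).prod) := by
  induction l with
  | nil => simp
  | cons i l ih =>
    simp only [List.map_cons, List.prod_cons, map_mul, involute_ι, mul_assoc, ih]
    rcases eq_or_ne i j with rfl | hij
    · simp [pow_succ]
    · have h : ι q (b i) * ι q (b j) = -(ι q (b j) * ι q (b i)) := by
        rw [eq_neg_iff_add_eq_zero, ι_mul_ι_add_swap]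
        have := hb hij
        simp only [QuadraticMap.polarBilin_apply_apply] at this
        rw [this, map_zero]
      rw [List.count_cons_of_ne hij, mul_smul_comm, ← mul_assoc, neg_mul, h, neg_neg, mul_assoc]

/-- The product in `C(q)` of the vectors `b i` for `i ∈ I`, in some order. -/
noncomputable def prodι (q : QuadraticForm K M) (b : ι' → M) (I : Finset ι') :
    CliffordAlgebra q :=
  (I.toList.map fun i => ι q (b i)).prod

theorem involute_prodι (I : Finset ι') :
    involute (prodι q b I) = (-1 : K) ^ I.card • prodι q b I := by
  have h := involute_prod_map_ι (Q := q) (I.toList.map b)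
  simpa [prodι, List.map_map, Function.comp_def] using h

theorem involute_prodι_mul_ι [DecidableEq ι']
    (hb : Pairwise fun i j => q.polarBilin (b i) (b j) = 0)
    (I : Finset ι') (j : ι') :
    involute (prodι q b I) * ι q (b j) =
      (-1 : K) ^ (if j ∈ I then 1 else 0) • (ι q (b j) * prodι q b I) := by
  rw [prodι, involute_prod_map_ι_mul_ι hb, List.Nodup.count I.nodup_toList]
  simp only [Finset.mem_toList]

theorem prodι_mul_ι [DecidableEq ι']
    (hb : Pairwise fun i j => q.polarBilin (b i) (b j) = 0)
    (I : Finset ι') (j : ι') :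
    prodι q b I * ι q (b j) =
      (-1 : K) ^ (I.card + if j ∈ I then 1 else 0) • (ι q (b j) * prodι q b I) := by
  have h := involute_prodι_mul_ι hb I j
  rw [involute_prodι, smul_mul_assoc] at h
  rw [pow_add, mul_smul, ← h, smul_smul, ← mul_pow]
  simp

/-- Moving the factor `b j` of the second product past the first costs `|I|` signs, plus one more if
`j ∈ I`; the exponent is the sum over `j ∈ J`. -/
theorem prodι_mul_prodι [DecidableEq ι']
    (hb : Pairwise fun i j => q.polarBilin (b i) (b j) = 0)
    (I J : Finset ι') :
    prodι q b I * prodι q b J =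
      (-1 : K) ^ (I.card * J.card + (I ∩ J).card) • (prodι q b J * prodι q b I) := by
  have key : ∀ l : List ι', prodι q b I * (l.map fun i => ι q (b i)).prod =
      (-1 : K) ^ (l.map fun j => I.card + if j ∈ I then 1 else 0).sum •
        ((l.map fun i => ι q (b i)).prod * prodι q b I) := by
    intro l
    induction l with
    | nil => simp
    | cons j l ih =>
      simp only [List.map_cons, List.prod_cons, List.sum_cons]
      rw [← mul_assoc, prodι_mul_ι hb, smul_mul_assoc, mul_assoc, ih, mul_smul_comm, smul_smul,
        ← pow_add, mul_assoc]
  have h := key J.toList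
  rw [Finset.sum_map_toList, Finset.sum_add_distrib, Finset.sum_const, smul_eq_mul,
    Finset.sum_boole, Finset.filter_mem_eq_inter, Finset.inter_comm, mul_comm J.card] at h
  exact h

theorem isUnit_prodι (hb' : ∀ i, q (b i) ≠ 0) (I : Finset ι') : IsUnit (prodι q b I) := by
  refine List.prod_isUnit fun x hx => ?_
  obtain ⟨i, -, rfl⟩ := List.mem_map.mp hx
  exact isUnit_ι_of_isUnit q (hb' i).isUnit

/-- A lift to `C(q)` of the composite of the reflections in orthogonal vectors `b i`, `i ∈ I`, is
a multiple of the product of these vectors. -/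
theorem exists_eq_smul_prodι [CharZero K] [Fintype ι'] [DecidableEq ι']
    {b : Module.Basis ι' K M}
    (hb : Pairwise fun i j => q.polarBilin (b i) (b j) = 0) (hb' : ∀ i, q (b i) ≠ 0)
    {I : Finset ι'} {A : M →ₗ[K] M} (hA : ∀ i, A (b i) = if i ∈ I then -b i else b i)
    {x : CliffordAlgebra q} (hx : ∀ v, involute x * ι q v = ι q (A v) * x) :
    ∃ c : K, x = c • prodι q b I := by
  obtain ⟨u, hu⟩ := isUnit_prodι hb' I
  have huA : ∀ v, involute (u : CliffordAlgebra q) * ι q v = ι q (A v) * u := by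
    intro v
    have : LinearMap.mulLeft K (involute (u : CliffordAlgebra q)) ∘ₗ ι q =
        LinearMap.mulRight K (u : CliffordAlgebra q) ∘ₗ ι q ∘ₗ A := by
      refine b.ext fun i => ?_
      simp only [LinearMap.comp_apply, LinearMap.mulLeft_apply, LinearMap.mulRight_apply, hu, hA]
      rw [involute_prodι_mul_ι hb]
      split_ifs <;> simp
    exact LinearMap.congr_fun this v
  have hinv : involute (u : CliffordAlgebra q) * involute ((u⁻¹ : (CliffordAlgebra q)ˣ) :
      CliffordAlgebra q) = 1 := by rw [← map_mul, Units.mul_inv, map_one]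
  have hinv' : involute ((u⁻¹ : (CliffordAlgebra q)ˣ) : CliffordAlgebra q) *
      involute (u : CliffordAlgebra q) = 1 := by rw [← map_mul, Units.inv_mul, map_one]
  -- Two lifts of the same map differ by an element that twisted-commutes with every vector, hence
  -- by a scalar.
  obtain ⟨c, hc⟩ := mem_range_algebraMap_of_involute_mul_ι_eq b hb hb'
    (((u⁻¹ : (CliffordAlgebra q)ˣ) : CliffordAlgebra q) * x) fun v => by
      have h : ι q (A v) =
          involute (u : CliffordAlgebra q) * ι q v * ((u⁻¹ : (CliffordAlgebra q)ˣ) : _) := by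
        rw [huA, mul_assoc, Units.mul_inv, mul_one]
      rw [map_mul, mul_assoc, hx, h, ← mul_assoc, ← mul_assoc, ← mul_assoc, hinv', one_mul,
        mul_assoc]
  refine ⟨c, ?_⟩
  have h1 : x = u * (((u⁻¹ : (CliffordAlgebra q)ˣ) : CliffordAlgebra q) * x) := by simp
  rw [h1, ← hc, hu, Algebra.smul_def]
  exact (Algebra.commutes c _).symm

/-- Lifts of two simultaneously diagonal orthogonal involutions commute up to a sign. -/
theorem mul_eq_smul_mul_of_lifts [CharZero K] [Fintype ι'] [DecidableEq ι']
    {b : Module.Basis ι' K M}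
    (hb : Pairwise fun i j => q.polarBilin (b i) (b j) = 0) (hb' : ∀ i, q (b i) ≠ 0)
    {I J : Finset ι'} {A B : M →ₗ[K] M} (hA : ∀ i, A (b i) = if i ∈ I then -b i else b i)
    (hB : ∀ i, B (b i) = if i ∈ J then -b i else b i)
    {x y : CliffordAlgebra q} (hx : ∀ v, involute x * ι q v = ι q (A v) * x)
    (hy : ∀ v, involute y * ι q v = ι q (B v) * y) :
    x * y = (-1 : K) ^ (I.card * J.card + (I ∩ J).card) • (y * x) := by
  obtain ⟨c, rfl⟩ := exists_eq_smul_prodι hb hb' hA hx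
  obtain ⟨d, rfl⟩ := exists_eq_smul_prodι hb hb' hB hy
  simp only [smul_mul_assoc, mul_smul_comm, prodι_mul_prodι hb I J, smul_smul]
  congr 1
  ring

end CliffordAlgebra

end Lifts

/-! ### Simultaneous diagonalization and traces of involutions -/

section Involutions

open Module

/-- Commuting involutions preserving a positive definite form are simultaneously diagonal in an
orthogonal basis. -/
theorem QuadraticMap.PosDef.exists_basis_of_commute_involutions {E : Type*} [AddCommGroup E]
    [Module ℝ E] [FiniteDimensional ℝ E] {Q : QuadraticForm ℝ E} (hQ : Q.PosDef)
    {A B : E →ₗ[ℝ] E} (hA : A * A = 1) (hB : B * B = 1) (hAB : Commute A B)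
    (hQA : ∀ v, Q (A v) = Q v) (hQB : ∀ v, Q (B v) = Q v) :
    ∃ (b : Basis (Fin (finrank ℝ E)) ℝ E) (I J : Finset (Fin (finrank ℝ E))),
      (Pairwise fun i j => Q.polarBilin (b i) (b j) = 0) ∧
      (∀ i, A (b i) = if i ∈ I then -b i else b i) ∧
      (∀ i, B (b i) = if i ∈ J then -b i else b i) := by
  classical
  let core : InnerProductSpace.Core ℝ E :=
    { inner := fun x y => Q.polarBilin x y
      conj_inner_symm := fun x y => by simp [QuadraticMap.polar_comm Q x y]
      re_inner_nonneg := fun x => by simpa using hQ.nonneg x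
      add_left := fun x y z => by simp
      smul_left := fun x y r => by simp
      definite := fun x hx => by simpa [hQ.anisotropic.eq_zero_iff] using hx }
  let : NormedAddCommGroup E := core.toNormedAddCommGroup
  let : InnerProductSpace ℝ E := InnerProductSpace.ofCore core.toCore
  have hinner : ∀ x y : E, inner ℝ x y = Q.polarBilin x y := fun _ _ => rfl
  -- An isometry that is its own inverse is self-adjoint.
  have hsymm : ∀ C : E →ₗ[ℝ] E, C * C = 1 → (∀ v, Q (C v) = Q v) → C.IsSymmetric := by
    intro C hC hQC x y
    have h1 : C (C y) = y := LinearMap.congr_fun hC y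
    rw [hinner, hinner]
    conv_lhs => rw [← h1]
    simp only [QuadraticMap.polarBilin_apply_apply, QuadraticMap.polar, ← map_add, hQC]
  -- The four possible eigenvalues `±1 ± 2` are distinct, so each eigenvector of `A + 2B` is an
  -- eigenvector of both `A` and `B`.
  have hT : (A + (2 : ℝ) • B).IsSymmetric :=
    (hsymm A hA hQA).add ((hsymm B hB hQB).smul (by simp))
  let b := hT.eigenvectorBasis rfl
  have hjoint : ∀ i, (A (b i) = b i ∨ A (b i) = -b i) ∧ (B (b i) = b i ∨ B (b i) = -b i) := by
    intro i
    set μ : ℝ := hT.eigenvalues rfl i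
    have hA' : ∀ v, A (A v) = v := LinearMap.congr_fun hA
    have hB' : ∀ v, B (B v) = v := LinearMap.congr_fun hB
    have hAB' : ∀ v, A (B v) = B (A v) := LinearMap.congr_fun hAB
    have hb0 : b i ≠ 0 := b.toBasis.ne_zero i |> fun h => by simpa using h
    have hμ : A (b i) + (2 : ℝ) • B (b i) = μ • b i := hT.apply_eigenvectorBasis rfl i
    have hsign : ∀ (C : E →ₗ[ℝ] E) (c : ℝ), (∀ v, C (C v) = v) → C (b i) = c • b i →
        c = 1 ∨ c = -1 := by
      intro C c hC hc
      have h1 := hC (b i)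
      rw [hc, map_smul, hc, smul_smul] at h1
      have h2 : (c * c - 1) • b i = 0 := by rw [sub_smul, h1, one_smul, sub_self]
      have h3 := (smul_eq_zero.mp h2).resolve_right hb0
      exact mul_self_eq_one_iff.mp (sub_eq_zero.mp h3)
    -- Since `(A + 2B)² = 5 + 4AB`, the product `AB` acts on `b i` by a scalar `κ = ±1`. Then `A =
    -- κB` on `b i`, and `(κ + 2) B (b i) = μ • b i` can be solved.
    have h1 : μ • (μ • b i) = (5 : ℝ) • b i + (4 : ℝ) • A (B (b i)) := by
      calc μ • (μ • b i) = (A + (2 : ℝ) • B) (A (b i) + (2 : ℝ) • B (b i)) := by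
            rw [hμ, map_smul]; congr 1; exact hμ.symm
        _ = _ := by
            simp only [LinearMap.add_apply, LinearMap.smul_apply, map_add, map_smul, hA', hB',
              hAB']
            module
    have h2 : (A * B) (b i) = ((μ * μ - 5) / 4) • b i := by
      have h3 : A (B (b i)) = (1 / 4 : ℝ) • (μ • (μ • b i) - (5 : ℝ) • b i) := by
        rw [h1]; module
      rw [Module.End.mul_apply, h3]; module
    set κ := (μ * μ - 5) / 4
    have hκ : κ = 1 ∨ κ = -1 := hsign (A * B) κ (fun v => by
      simp only [Module.End.mul_apply, hAB', hA', hB']) h2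
    have h3 : A (b i) = κ • B (b i) := by
      rw [← map_smul, ← h2, Module.End.mul_apply, hAB', hB']
    have hκ2 : κ + 2 ≠ 0 := by rcases hκ with h | h <;> rw [h] <;> norm_num
    have h4 : B (b i) = (μ / (κ + 2)) • b i := by
      have : (κ + 2) • B (b i) = μ • b i := by rw [← hμ, h3]; module
      rw [div_eq_inv_mul, mul_smul, ← this, smul_smul, inv_mul_cancel₀ hκ2, one_smul]
    have h5 : A (b i) = (κ * (μ / (κ + 2))) • b i := by rw [h3, h4, smul_smul]
    constructor
    · rw [h5]
      rcases hsign A _ hA' h5 with h | h <;> rw [h] <;> simp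
    · rw [h4]
      rcases hsign B _ hB' h4 with h | h <;> rw [h] <;> simp
  refine ⟨b.toBasis, Finset.univ.filter fun i => A (b i) = -b i,
    Finset.univ.filter fun i => B (b i) = -b i, fun i j hij => ?_, fun i => ?_, fun i => ?_⟩
  · change Q.polarBilin (b.toBasis i) (b.toBasis j) = 0
    rw [← hinner]
    simpa using b.orthonormal.2 hij
  · rcases (hjoint i).1 with h | h
    · by_cases h' : A (b i) = -b i <;> simp [h', h]
    · simp [h]
  · rcases (hjoint i).2 with h | h
    · by_cases h' : B (b i) = -b i <;> simp [h', h]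
    · simp [h]

theorem LinearMap.trace_eq_card_sub_of_basis {R M ι' : Type*} [CommRing R] [AddCommGroup M]
    [Module R M] [Fintype ι'] [DecidableEq ι'] (b : Basis ι' R M) {I : Finset ι'} {A : M →ₗ[R] M}
    (hA : ∀ i, A (b i) = if i ∈ I then -b i else b i) :
    LinearMap.trace R M A = Fintype.card ι' - 2 * I.card := by
  have h : ∀ i, LinearMap.toMatrix b b A i i = 1 - 2 * if i ∈ I then 1 else 0 := by
    intro i
    rw [LinearMap.toMatrix_apply, hA]
    split_ifs <;> simp
    norm_num
  rw [LinearMap.trace_eq_matrix_trace R b, Matrix.trace]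
  simp only [Matrix.diag_apply, h, Finset.sum_sub_distrib, ← Finset.mul_sum, Finset.sum_boole,
    Finset.filter_univ_mem]
  simp

/-- `(1 - A) / 2` projects onto the `-1`-eigenspace, and the trace of a projection is its rank. -/
theorem LinearMap.trace_eq_of_mul_self_eq_one {K M : Type*} [Field K] [CharZero K]
    [AddCommGroup M] [Module K M] [FiniteDimensional K M] {A : M →ₗ[K] M} (hA : A * A = 1) :
    LinearMap.trace K M A = finrank K M - 2 * finrank K (Module.End.eigenspace A (-1)) := by
  have hA' : ∀ v, A (A v) = v := LinearMap.congr_fun hA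
  have hproj : LinearMap.IsProj (Module.End.eigenspace A (-1)) ((2⁻¹ : K) • (1 - A)) := by
    refine ⟨fun v => ?_, fun v hv => ?_⟩
    · rw [Module.End.mem_eigenspace_iff]
      simp only [LinearMap.smul_apply, LinearMap.sub_apply, Module.End.one_apply, map_smul,
        map_sub, hA']
      module
    · rw [Module.End.mem_eigenspace_iff] at hv
      simp only [LinearMap.smul_apply, LinearMap.sub_apply, Module.End.one_apply, hv]
      module
  have h := hproj.trace
  rw [map_smul, map_sub, LinearMap.trace_one, smul_eq_mul] at h
  rw [← h]
  field_simp
  ring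

end Involutions

/-! ### The commutation sign for external tensor products -/

section ExternalTensor

open Module

theorem Finset.card_symmDiff_add_two_mul_card_inter {α : Type*} [DecidableEq α] (I J : Finset α) :
    (symmDiff I J).card + 2 * (I ∩ J).card = I.card + J.card := by
  have h1 := Finset.card_sdiff_add_card_inter I J
  have h2 := Finset.card_sdiff_add_card_inter J I
  rw [Finset.inter_comm J I] at h2
  have h3 : (symmDiff I J).card = (I \ J).card + (J \ I).card :=
    Finset.card_union_of_disjoint disjoint_sdiff_sdiff
  omega

/-- The images of two symmetric groups in a group commute if the images of their transpositions do. -/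
theorem Equiv.Perm.commute_of_forall_isSwap {α β P : Type*} [Finite α] [Finite β]
    [DecidableEq α] [DecidableEq β] [Group P] (f : Equiv.Perm α →* P) (f' : Equiv.Perm β →* P)
    (h : ∀ σ τ, σ.IsSwap → τ.IsSwap → Commute (f σ) (f' τ)) (σ : Equiv.Perm α)
    (τ : Equiv.Perm β) : Commute (f σ) (f' τ) := by
  have h1 : ∀ σ τ, σ.IsSwap → Commute (f σ) (f' τ) := by
    intro σ τ hσ
    induction τ using Equiv.Perm.swap_induction_on with
    | one => simp
    | swap_mul τ i j hij ih => rw [map_mul]; exact (h σ _ hσ ⟨i, j, hij, rfl⟩).mul_right ih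
  induction σ using Equiv.Perm.swap_induction_on with
  | one => simp
  | swap_mul σ i j hij ih => rw [map_mul]; exact (h1 _ τ ⟨i, j, hij, rfl⟩).mul_left ih

namespace PinLift

variable {V V' : Type*} [AddCommGroup V] [Module ℝ V] [AddCommGroup V'] [Module ℝ V']

theorem extTensor_apply {G G' : Type*} [Group G] [Group G'] (π : Representation ℝ G V)
    (π' : Representation ℝ G' V') (g : G × G') :
    extTensor π π' g = TensorProduct.map (π g.1) (π' g.2) := rfl

theorem IsSpinorial.comp {G H : Type*} [Group G] [Group H] {Q : QuadraticForm ℝ V}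
    {π : Representation ℝ G V} (h : IsSpinorial Q π) (φ : H →* G) :
    IsSpinorial Q (π.comp φ : Representation ℝ H V) := by
  obtain ⟨f, hf⟩ := h
  exact ⟨f.comp φ, fun g => hf (φ g)⟩

variable [FiniteDimensional ℝ V] [FiniteDimensional ℝ V']

/-- Lifts to `C(V ⊗ V')` of `a ⊗ 1` and `1 ⊗ a'`, for involutions `a` and `a'`, commute up to the
sign `(-1) ^ ((dim (V ⊗ V') + 1) g g')`. -/
theorem mul_eq_smul_mul_of_lifts_tensor {Q : QuadraticForm ℝ (V ⊗[ℝ] V')} (hQ : Q.PosDef)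
    {a : V →ₗ[ℝ] V} {a' : V' →ₗ[ℝ] V'} (ha : a * a = 1) (ha' : a' * a' = 1)
    (hQa : ∀ v, Q (TensorProduct.map a 1 v) = Q v) (hQa' : ∀ v, Q (TensorProduct.map 1 a' v) = Q v)
    {x y : Cl Q}
    (hx : ∀ v, CliffordAlgebra.involute x * CliffordAlgebra.ι (-Q) v =
      CliffordAlgebra.ι (-Q) (TensorProduct.map a 1 v) * x)
    (hy : ∀ v, CliffordAlgebra.involute y * CliffordAlgebra.ι (-Q) v =
      CliffordAlgebra.ι (-Q) (TensorProduct.map 1 a' v) * y) :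
    x * y = (-1 : ℝ) ^ ((finrank ℝ (V ⊗[ℝ] V') + 1) *
      finrank ℝ (Module.End.eigenspace a (-1)) *
      finrank ℝ (Module.End.eigenspace a' (-1))) • (y * x) := by
  have hcomp : (TensorProduct.map a 1 : V ⊗[ℝ] V' →ₗ[ℝ] V ⊗[ℝ] V') * TensorProduct.map 1 a' =
      TensorProduct.map a a' := by
    rw [← TensorProduct.map_mul, mul_one, one_mul]
  obtain ⟨b, I, J, hb, hI, hJ⟩ := hQ.exists_basis_of_commute_involutions
    (A := TensorProduct.map a 1) (B := TensorProduct.map 1 a')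
    (by rw [← TensorProduct.map_mul, ha, mul_one, TensorProduct.map_one])
    (by rw [← TensorProduct.map_mul, ha', mul_one, TensorProduct.map_one])
    (by
      change _ * _ = _ * _
      rw [hcomp, ← TensorProduct.map_mul, mul_one, one_mul]) hQa hQa'
  -- The product `a ⊗ a'` is negative on the symmetric difference, so its trace, combined with `|I|`
  -- and `|J|`, determines `|I ∩ J|`.
  have hIJ : ∀ i, TensorProduct.map a a' (b i) = if i ∈ symmDiff I J then -b i else b i := by
    intro i
    rw [← hcomp, Module.End.mul_apply, hJ]
    by_cases h1 : i ∈ I <;> by_cases h2 : i ∈ J <;> simp [h1, h2, hI, Finset.mem_symmDiff]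
  have key := CliffordAlgebra.mul_eq_smul_mul_of_lifts (q := -Q)
    (fun i j hij => by
      have := hb hij
      simp only [QuadraticMap.polarBilin_apply_apply] at this
      simp [QuadraticMap.polar_neg, this])
    (fun i => by simpa using (hQ _ (b.ne_zero i)).ne') hI hJ hx hy
  rw [key]
  congr 2
  have tI := LinearMap.trace_eq_card_sub_of_basis b hI
  have tJ := LinearMap.trace_eq_card_sub_of_basis b hJ
  have tIJ := LinearMap.trace_eq_card_sub_of_basis b hIJ
  rw [LinearMap.trace_tensorProduct'] at tI tJ tIJ
  rw [LinearMap.trace_eq_of_mul_self_eq_one ha] at tI tIJ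
  rw [LinearMap.trace_eq_of_mul_self_eq_one ha'] at tJ tIJ
  rw [LinearMap.trace_one] at tI tJ
  have hs : ((symmDiff I J).card : ℝ) + 2 * (I ∩ J).card = I.card + J.card := by
    exact_mod_cast Finset.card_symmDiff_add_two_mul_card_inter I J
  simp only [Fintype.card_fin, finrank_tensorProduct, Nat.cast_mul] at tI tJ tIJ
  set g := finrank ℝ (Module.End.eigenspace a (-1))
  set g' := finrank ℝ (Module.End.eigenspace a' (-1))
  have e1 : I.card = g * finrank ℝ V' := by
    have : (I.card : ℝ) = g * finrank ℝ V' := by linarith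
    exact_mod_cast this
  have e2 : J.card = finrank ℝ V * g' := by
    have : (J.card : ℝ) = finrank ℝ V * g' := by linarith
    exact_mod_cast this
  have e3 : (I ∩ J).card = g * g' := by
    have : ((I ∩ J).card : ℝ) = g * g' := by linarith
    exact_mod_cast this
  rw [e1, e2, e3, finrank_tensorProduct]
  ring

theorem involute_mul_ι_of_rho {W : Type*} [AddCommGroup W] [Module ℝ W]
    {Q : QuadraticForm ℝ W} {x : cliffordGroup Q} {A : W →ₗ[ℝ] W} (h : rho Q x = A) (v : W) :
    CliffordAlgebra.involute ((x : (Cl Q)ˣ) : Cl Q) * CliffordAlgebra.ι (-Q) v =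
      CliffordAlgebra.ι (-Q) (A v) * ((x : (Cl Q)ˣ) : Cl Q) := by
  rw [← h, ι_rho, mul_assoc, Units.inv_mul, mul_one]

/-- The multiplicity of `-1` in the image of a transposition does not depend on the
transposition. -/
theorem finrank_eigenspace_eq_gMult {n : ℕ} (hn : 2 ≤ n)
    (π : Representation ℝ (Equiv.Perm (Fin n)) V) {σ : Equiv.Perm (Fin n)} (hσ : σ.IsSwap) :
    finrank ℝ (Module.End.eigenspace (π σ) (-1)) = gMult n hn π := by
  have hs : (s₁ n hn).IsSwap := ⟨_, _, by simp, rfl⟩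
  have hsq : ∀ τ : Equiv.Perm (Fin n), τ.IsSwap → π τ * π τ = 1 := by
    rintro τ ⟨i, j, -, rfl⟩
    rw [← map_mul, Equiv.swap_mul_self, map_one]
  -- Transpositions are conjugate, and the trace of an involution determines the multiplicity of
  -- `-1`.
  have htr : LinearMap.trace ℝ V (π σ) = LinearMap.trace ℝ V (π (s₁ n hn)) := by
    obtain ⟨i, j, hij, rfl⟩ := hσ
    obtain ⟨k, l, hkl, hs'⟩ := hs
    rw [hs']
    obtain ⟨c, hc⟩ := isConj_iff.mp (Equiv.Perm.isConj_swap hij hkl)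
    rw [← hc, map_mul, LinearMap.trace_mul_comm, ← map_mul, inv_mul_cancel_left]
  rw [LinearMap.trace_eq_of_mul_self_eq_one (hsq σ hσ),
    LinearMap.trace_eq_of_mul_self_eq_one (hsq _ hs)] at htr
  have : (finrank ℝ (Module.End.eigenspace (π σ) (-1)) : ℝ) = gMult n hn π := by
    rw [gMult]; linarith
  exact_mod_cast this

/-- Lifts to `Pin(V ⊗ V')` of `(σ, 1)` and `(1, τ)`, for transpositions `σ` and `τ`, commute if
and only if `(dim (V ⊗ V') + 1) g g'` is even. -/
theorem commute_lifts_of_isSwap_iff {n n' : ℕ} (hn : 2 ≤ n) (hn' : 2 ≤ n')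
    {π : Representation ℝ (Equiv.Perm (Fin n)) V} {π' : Representation ℝ (Equiv.Perm (Fin n')) V'}
    {Q : QuadraticForm ℝ (V ⊗[ℝ] V')} (hQ : Q.PosDef) (horth : IsOrthogonal Q (extTensor π π'))
    {σ : Equiv.Perm (Fin n)} {τ : Equiv.Perm (Fin n')} (hσ : σ.IsSwap) (hτ : τ.IsSwap)
    {x y : Pin Q} (hx : rho Q x = extTensor π π' (σ, 1)) (hy : rho Q y = extTensor π π' (1, τ)) :
    Commute x y ↔ (finrank ℝ (V ⊗[ℝ] V') + 1) * gMult n hn π * gMult n' hn' π' ≡ 0 [MOD 2] := by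
  have hsq : π σ * π σ = 1 := by
    obtain ⟨i, j, -, rfl⟩ := hσ
    rw [← map_mul, Equiv.swap_mul_self, map_one]
  have hsq' : π' τ * π' τ = 1 := by
    obtain ⟨i, j, -, rfl⟩ := hτ
    rw [← map_mul, Equiv.swap_mul_self, map_one]
  have e1 : extTensor π π' (σ, 1) = TensorProduct.map (π σ) 1 := by simp [extTensor_apply]
  have e2 : extTensor π π' (1, τ) = TensorProduct.map 1 (π' τ) := by simp [extTensor_apply]
  have key := mul_eq_smul_mul_of_lifts_tensor hQ hsq hsq' (by rw [← e1]; exact horth _)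
    (by rw [← e2]; exact horth _) (involute_mul_ι_of_rho (hx.trans e1))
    (involute_mul_ι_of_rho (hy.trans e2))
  rw [finrank_eigenspace_eq_gMult hn π hσ, finrank_eigenspace_eq_gMult hn' π' hτ] at key
  have hcomm : Commute x y ↔
      (((x : cliffordGroup Q) : (Cl Q)ˣ) : Cl Q) * (((y : cliffordGroup Q) : (Cl Q)ˣ) : Cl Q) =
      (((y : cliffordGroup Q) : (Cl Q)ˣ) : Cl Q) * (((x : cliffordGroup Q) : (Cl Q)ˣ) : Cl Q) := by
    rw [commute_iff_eq, Subtype.ext_iff, Subtype.ext_iff, Units.ext_iff]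
    simp
  rw [hcomm, key, Nat.modEq_zero_iff_dvd, ← even_iff_two_dvd]
  refine ⟨fun h => ?_, fun h => by rw [h.neg_one_pow, one_smul]⟩
  -- If the exponent were odd, the lifts would both commute and anticommute, so `2yx = 0`, although
  -- `yx` is a unit.
  by_contra hodd
  rw [(Nat.not_even_iff_odd.mp hodd).neg_one_pow, neg_smul, one_smul, neg_eq_iff_add_eq_zero,
    ← two_smul ℝ] at h
  have h0 := (smul_eq_zero.mp h).resolve_left two_ne_zero
  have hu : IsUnit ((((y : cliffordGroup Q) : (Cl Q)ˣ) : Cl Q) *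
      (((x : cliffordGroup Q) : (Cl Q)ˣ) : Cl Q)) := (Units.isUnit _).mul (Units.isUnit _)
  rw [h0] at hu
  exact not_isUnit_zero hu

end PinLift

end ExternalTensor

theorem theorem1p2 (n n' : ℕ) (hn : 2 ≤ n) (hn' : 2 ≤ n')
    {V V' : Type*} [AddCommGroup V] [Module ℝ V] [FiniteDimensional ℝ V]
    [AddCommGroup V'] [Module ℝ V'] [FiniteDimensional ℝ V']
    (π : Representation ℝ (Equiv.Perm (Fin n)) V)
    (π' : Representation ℝ (Equiv.Perm (Fin n')) V')
    (Q : QuadraticForm ℝ (V ⊗[ℝ] V')) (hQ : Q.PosDef)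
    (horth : PinLift.IsOrthogonal Q (PinLift.extTensor π π')) :
    PinLift.IsSpinorial Q (PinLift.extTensor π π') ↔
      PinLift.IsSpinorial Q (PinLift.restrictTo (PinLift.extTensor π π')
        (Subgroup.prod ⊤ ⊥)) ∧
      PinLift.IsSpinorial Q (PinLift.restrictTo (PinLift.extTensor π π')
        (Subgroup.prod ⊥ ⊤)) ∧
      (Module.finrank ℝ (V ⊗[ℝ] V') + 1) * PinLift.gMult n hn π * PinLift.gMult n' hn' π' ≡ 0
        [MOD 2] := by
  constructor
  · intro h
    refine ⟨h.comp _, h.comp _, ?_⟩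
    obtain ⟨f, hf⟩ := h
    refine (PinLift.commute_lifts_of_isSwap_iff hn hn' hQ horth (σ := PinLift.s₁ n hn)
      (τ := PinLift.s₁ n' hn') ⟨_, _, by simp, rfl⟩ ⟨_, _, by simp, rfl⟩ (hf _) (hf _)).mp ?_
    -- The elements `(s₁, 1)` and `(1, s₁)` commute in the product group, hence so do their images
    -- under `f`.
    exact Commute.map (by simp [commute_iff_eq]) f
  · rintro ⟨⟨f₁, hf₁⟩, ⟨f₂, hf₂⟩, hpar⟩
    let j₁ : Equiv.Perm (Fin n) →* (Subgroup.prod ⊤ ⊥ :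
        Subgroup (Equiv.Perm (Fin n) × Equiv.Perm (Fin n'))) :=
      (MonoidHom.inl _ _).codRestrict _ fun σ => by simp [Subgroup.mem_prod]
    let j₂ : Equiv.Perm (Fin n') →* (Subgroup.prod ⊥ ⊤ :
        Subgroup (Equiv.Perm (Fin n) × Equiv.Perm (Fin n'))) :=
      (MonoidHom.inr _ _).codRestrict _ fun σ => by simp [Subgroup.mem_prod]
    have h₁ : ∀ σ, PinLift.rho Q (f₁ (j₁ σ)) = PinLift.extTensor π π' (σ, 1) := fun σ => hf₁ (j₁ σ)
    have h₂ : ∀ τ, PinLift.rho Q (f₂ (j₂ τ)) = PinLift.extTensor π π' (1, τ) := fun τ => hf₂ (j₂ τ)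
    have hcomm : ∀ σ τ, Commute (f₁.comp j₁ σ) (f₂.comp j₂ τ) :=
      Equiv.Perm.commute_of_forall_isSwap _ _ fun σ τ hσ hτ =>
        (PinLift.commute_lifts_of_isSwap_iff hn hn' hQ horth hσ hτ (h₁ σ) (h₂ τ)).mpr hpar
    refine ⟨(f₁.comp j₁).noncommCoprod (f₂.comp j₂) hcomm, fun g => ?_⟩
    rw [MonoidHom.noncommCoprod_apply, Subgroup.coe_mul, map_mul, MonoidHom.comp_apply,
      MonoidHom.comp_apply, h₁, h₂, ← map_mul, Prod.mk_mul_mk, mul_one, one_mul]
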